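/- **Setting.** Fix $n\ge 2$. An $n$-agent rank-based (position) auction is given by weights $1\ge w_1\ge\dots\ge w_n\ge 0$: the agent with the $k$-th highest bid is served with probability $w_k$. Its allocation rule in quantile space is $x_w(q)=\sum_{k=1}^n w_k\binom{n-1}{k-1}q^{n-k}(1-q)^{k-1}$, $q\in[0,1]$. The $k$-unit auction has $w_1=\dots=w_k=1$ and $w_{k+1}=\dots=w_n=0$. Values lie in $[0,1]$, and their distribution is given by a nondecreasing value function $v:[0,1]\to[0,1]$ of the quantile $q$, which is uniform on $[0,1]$. The per-agent revenue of the auction with weights $w$ is $P_w=\int_0^1 x_w'(q)\,v(q)(1-q)\,dq$; $P_k$ denotes the revenue of the $k$-unit auction. The bids from an auction $C$ are i.i.d. draws of $b(q)$, $q$ uniform on $[0,1]$, where $b:[0,1]\to[0,\infty)$ is a strictly increasing symmetric Bayes–Nash equilibrium bid function of the all-pay auction $C$. **Corollary.** Let $B$ be the position auction with weights $w_1=1$, $w_k=1/2$ for $1<k<n$, and $w_n=0$, i.e. the uniform mix of the $1$-unit and the $(n-1)$-unit auction. Let $N\ge1$, let $A$ be any rank-based auction, let $0<\varepsilon\le1$,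 and let $C=(1-\varepsilon)A+\varepsilon B$. Then there are estimators $\hat P_1,\dots,\hat P_n$, weighted order statistics $\hat P_k=\sum_{i=1}^N c_{k,i}\,\hat b_{i}$ of the sorted bids $\hat b_1\le\dots\le\hat b_N$ with coefficients $c_{k,i}$ that depend only on $n,N,\varepsilon,A$ and not on the value distribution, such that for every value distribution on $[0,1]$ and $N$ bids from $C$ (all-pay), $$\mathbf E\Big[\max_{1\le k\le n}|\hat P_k-P_k|\Big]\le\frac{40\,n\,(n+\log(1/\varepsilon))}{\sqrt N},$$ and, consequently, for every position auction with weights $y$, the estimate $\hat P_y=\sum_{k=1}^n (y_k-y_{k+1})\hat P_k$ (with $y_{n+1}=0$) satisfies $\mathbf E|\hat P_y-P_y|\le 40\,n\,(n+\log(1/\varepsilon))/\sqrt N$. In particular $B$ is a universal B test: there is a constant $K$ depending only on $n$ such that for every $N\ge1$, every rank-based $A$ and every $0<\varepsilon\le 1/2$, all of $P_1,\dots,P_n$ can be estimated simultaneously, by such weighted order statistics of $N$ bids from $C=(1-\varepsilon)A+\varepsilon B$, with $\mathbf E[\max_k|\hat P_k-P_k|]\le K\log(1/\varepsilon)/\sqrt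 N$ for every value distribution on $[0,1]$. -/

import Mathlib

open MeasureTheory

noncomputable section

namespace PositionAuction

/-- `w 1 ≥ w 2 ≥ ⋯ ≥ w n` in `[0, 1]`: the position weights of an `n`-agent rank-based auction
(`w k` is the probability that the agent with the `k`-th highest bid is served).
Only the values `w 1, …, w n` matter. -/
structure IsPositionWeights (n : ℕ) (w : ℕ → ℝ) : Prop where
  mem_unit : ∀ k ∈ Set.Icc 1 n, w k ∈ Set.Icc (0 : ℝ) 1
  antitone : AntitoneOn w (Set.Icc 1 n)

/-- The highest-`k`-bids-win (`k`-unit) auction. -/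
def kUnit (k : ℕ) : ℕ → ℝ := fun j => if j ≤ k then 1 else 0

/-- The position auction with weights `1, 1/2, …, 1/2, 0`. -/
def universalB (n : ℕ) : ℕ → ℝ := fun k => if k = 1 then 1 else if k < n then 1 / 2 else 0

/-- The auction `C = (1 - ε) A + ε B`, for position weights `a` of `A` and `b` of `B`. -/
def mix (ε : ℝ) (a b : ℕ → ℝ) : ℕ → ℝ := fun k => (1 - ε) * a k + ε * b k

/-- The marginal weights `w k - w (k + 1)`, where `w (n + 1)` is read as `0`. -/
def marginal (n : ℕ) (w : ℕ → ℝ) (k : ℕ) : ℝ := if k = n then w n else w k - w (k + 1)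

/-- The allocation rule in quantile space: the probability that an agent with value quantile `q`
(`q = 1` is the strongest type) is served when agents are ranked by quantile; this agent has
rank `k` with probability `(n-1 choose k-1) q ^ (n-k) (1-q) ^ (k-1)`. -/
def alloc (n : ℕ) (w : ℕ → ℝ) (q : ℝ) : ℝ :=
  ∑ k ∈ Finset.Icc 1 n, w k * (((n - 1).choose (k - 1) : ℝ) * q ^ (n - k) * (1 - q) ^ (k - 1))

/-- A value distribution on `[0, 1]`, given by its value (quantile) function `v`. -/
structure IsValueFunction (v : ℝ → ℝ) : Prop where
  monotone : MonotoneOn v (Set.Icc 0 1)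
  mem_unit : ∀ q ∈ Set.Icc (0 : ℝ) 1, v q ∈ Set.Icc (0 : ℝ) 1

/-- The revenue curve `R q = v q (1 - q)`. -/
def revenueCurve (v : ℝ → ℝ) (q : ℝ) : ℝ := v q * (1 - q)

/-- The per-agent revenue `P_y = E_q[y'(q) R(q)]` of the position auction with weights `w`,
whose allocation rule is `y = alloc n w`. -/
def revenue (n : ℕ) (w : ℕ → ℝ) (v : ℝ → ℝ) : ℝ :=
  ∫ q in (0 : ℝ)..1, deriv (alloc n w) q * revenueCurve v q

/-- Quantiles are uniform on `[0, 1]`. -/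
def quantileLaw : Measure ℝ := volume.restrict (Set.Icc 0 1)

/-- The probability of being served for an agent who bids `z` when the other `n - 1` agents have
independent uniform quantiles and use the bid function `b`. (Ties have probability zero for a
strictly increasing `b`, so the rule that breaks them plays no role.) -/
def serviceProb (n : ℕ) (w : ℕ → ℝ) (b : ℝ → ℝ) (z : ℝ) : ℝ :=
  ∫ q : Fin (n - 1) → ℝ, w (1 + (Finset.univ.filter fun j => z < b (q j)).card)
    ∂(Measure.pi fun _ => quantileLaw)

/-- `b` is a symmetric, strictly increasing Bayes–Nash equilibrium of the `n`-agent all-pay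
position auction with weights `w`, as a function of the agent's quantile. -/
structure IsAllPayEquilibrium (n : ℕ) (w : ℕ → ℝ) (v b : ℝ → ℝ) : Prop where
  strictMono : StrictMonoOn b (Set.Icc 0 1)
  nonneg : ∀ q ∈ Set.Icc (0 : ℝ) 1, 0 ≤ b q
  bestResponse : ∀ q ∈ Set.Icc (0 : ℝ) 1, ∀ z : ℝ, 0 ≤ z →
    v q * serviceProb n w b z - z ≤ v q * serviceProb n w b (b q) - b q

/-- The law of `N` independent bids from the bid function `b`. -/
def sampleLaw (N : ℕ) (b : ℝ → ℝ) : Measure (Fin N → ℝ) :=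
  Measure.pi fun _ => quantileLaw.map b

/-- The weighted order statistic `∑ i, c i * β₍ᵢ₎`, for the sorted bids `β₍₁₎ ≤ ⋯ ≤ β₍N₎`. -/
def orderStat {N : ℕ} (c : Fin N → ℝ) (β : Fin N → ℝ) : ℝ :=
  ∑ i, c i * β (Tuple.sort β i)

/-- From `N` equilibrium bids of the all-pay auction with weights `w`, the `n` estimators with
coefficients `c 1, …, c n` estimate all multi-unit revenues simultaneously with expected
(maximal) absolute error at most `δ`, whatever the value distribution is. -/
def EstimatesMultiUnit (n N : ℕ) (w : ℕ → ℝ) (c : ℕ → Fin N → ℝ) (δ : ℝ) : Prop :=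
  ∀ v b : ℝ → ℝ, IsValueFunction v → IsAllPayEquilibrium n w v b →
    ∫⁻ β, (⨆ k ∈ Set.Icc 1 n, ENNReal.ofReal |orderStat (c k) β - revenue n (kUnit k) v|)
      ∂(sampleLaw N b) ≤ ENNReal.ofReal δ

/-- The same bids, and the estimate of each position auction as the combination of the estimates
of the multi-unit revenues given by its marginal weights, estimate the revenue of every position
auction with expected absolute error at most `δ`. -/
def EstimatesPosition (n N : ℕ) (w : ℕ → ℝ) (c : ℕ → Fin N → ℝ) (δ : ℝ) : Prop :=
  ∀ v b : ℝ → ℝ, IsValueFunction v → IsAllPayEquilibrium n w v b →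
    ∀ y : ℕ → ℝ, IsPositionWeights n y →
      ∫⁻ β, ENNReal.ofReal
          |∑ k ∈ Finset.Icc 1 n, marginal n y k * orderStat (c k) β - revenue n y v|
        ∂(sampleLaw N b) ≤ ENNReal.ofReal δ

/-- A universal B test: for every rank-based `A`, all multi-unit revenues can be estimated from
bids of `C = (1 - ε) A + ε B` at the rate `1 / √N`, with an error that depends on `ε` as
`O(log (1/ε))`; the constant depends on nothing but `n` and `B`. -/
def IsUniversalBTest (n : ℕ) (b : ℕ → ℝ) : Prop :=
  ∃ K : ℝ, ∀ N : ℕ, 1 ≤ N → ∀ a : ℕ → ℝ, IsPositionWeights n a → ∀ ε : ℝ, 0 < ε → ε ≤ 1 / 2 →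
    ∃ c : ℕ → Fin N → ℝ,
      EstimatesMultiUnit n N (mix ε a b) c (K * Real.log (1 / ε) / √N)

end PositionAuction

end

/-!
The error of the estimators is `O(n² / √N)`, uniformly in `A` and in `ε > 0`; the term
`log (1 / ε)` is not needed. Write `n = m + 2`, and let `g = allocSlope m w` be the derivative of
the allocation rule of the auction that is run, a combination with nonnegative coefficients
`d j = slopeCoeff m w j` of the binomial probabilities `binom m j`. For `k < n` the allocation rule
of the `k`-unit auction has derivative `(m + 1) * binom m a` with `a = m + 1 - k`; for `k = n` it
has derivative `0`.

*Order statistics.* The payment identity of the all-pay auction,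
`IsAllPayEquilibrium.bid_eq_integral`, gives `b q = ∫₀^q v g`. If the coefficients of a weighted
order statistic are the differences `Z i - Z (i + 1)` of a function `Z` with `Z N = 0`, summation by
parts (`orderStat_bidIntegral`) turns it into `∫ v(t) g(t) Z(S_t) dt`, where `S_t` is the number of
sampled quantiles that are at most `t`, a binomial variable with `N` trials. Since
`P_k = ∫ v(t) (1 - t) (m + 1) binom m a t dt` and `0 ≤ v ≤ 1`, the error is at most
`∫ |g(t) Z(S_t) - (1 - t) (m + 1) binom m a t| dt`, and it remains to choose `Z` so that `Z(S_t)`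
estimates `(1 - t) (m + 1) binom m a t / g(t)` well in the metric weighted by `g`.

*The estimated ratio.* A product of binomial weights is a multiple of a single one:
`binom m j t * binom (N - 1) S t = H j * binom (N - 1 + m) (S + j) t` with `0 ≤ H j ≤ 1`
(`mergeCoeff`). The choice `Z S = (1 - S / N) * H a / ∑ j, d j * H j` (`ratioEst`) makes the error
at `t`, multiplied by the probability of `S`, an average of differences
`binom (N - 1 + m) (S + j) t - binom (N - 1 + m) (S + a) t`, in which the sizes of the `d j` have
cancelled, plus a term from the replacement of `1 - t` by `1 - S / N`
(`abs_weighted_sub_le_windowVar`, `abs_slope_mul_ratioEst_sub_le`). Shifting a binomial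
distribution with `M` trials by one changes it by at most `1 / √((M + 1) t (1 - t))` in `ℓ¹`-norm
(`sum_abs_binom_sub_le`), which is an integrable function of `t`. The pointwise bound does not
depend on `a`, so it also bounds the maximum over all `k`, and Tonelli's theorem finishes the
estimate (`lintegral_errBound_le`, `estimatesMultiUnit_estimatorCoeff`).

The denominators `∑ j, d j * H j` have to be positive, and this is where `B` enters: it puts
a larger weight on the first position than on the second.
-/

namespace PositionAuction

/-! ### The binomial distribution -/

/-- The probability `C(M, j) t ^ j (1 - t) ^ (M - j)` of `j` successes in `M` trials; it vanishes
for `j > M`. -/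
noncomputable def binom (M j : ℕ) (t : ℝ) : ℝ := (M.choose j : ℝ) * t ^ j * (1 - t) ^ (M - j)

lemma binom_eq_eval (M j : ℕ) (t : ℝ) : binom M j t = (bernsteinPolynomial ℝ M j).eval t := by
  simp [binom, bernsteinPolynomial]

lemma binom_eq_zero {M j : ℕ} (h : M < j) (t : ℝ) : binom M j t = 0 := by
  simp [binom, Nat.choose_eq_zero_of_lt h]

lemma binom_nonneg (M j : ℕ) {t : ℝ} (ht : t ∈ Set.Icc (0 : ℝ) 1) : 0 ≤ binom M j t :=
  mul_nonneg (mul_nonneg (Nat.cast_nonneg _) (pow_nonneg ht.1 _))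
    (pow_nonneg (sub_nonneg.2 ht.2) _)

lemma binom_pos {M j : ℕ} (h : j ≤ M) {t : ℝ} (ht : t ∈ Set.Ioo (0 : ℝ) 1) : 0 < binom M j t :=
  mul_pos (mul_pos (Nat.cast_pos.2 (Nat.choose_pos h)) (pow_pos ht.1 _))
    (pow_pos (sub_pos.2 ht.2) _)

lemma continuous_binom (M j : ℕ) : Continuous (binom M j) := by
  unfold binom; fun_prop

lemma sum_binom (M : ℕ) (t : ℝ) : ∑ j ∈ Finset.range (M + 1), binom M j t = 1 := by
  simpa [Polynomial.eval_finsetSum, binom_eq_eval] using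
    congrArg (Polynomial.eval t) (bernsteinPolynomial.sum ℝ M)

lemma binom_le_one (M j : ℕ) {t : ℝ} (ht : t ∈ Set.Icc (0 : ℝ) 1) : binom M j t ≤ 1 := by
  rcases lt_or_ge M j with h | h
  · simp [binom_eq_zero h]
  · rw [← sum_binom M t]
    exact Finset.single_le_sum (f := fun j => binom M j t) (fun i _ => binom_nonneg M i ht)
      (Finset.mem_range.2 (by omega))

lemma sum_binom_mul_sq (M : ℕ) (t : ℝ) :
    ∑ j ∈ Finset.range (M + 1), binom M j t * ((j : ℝ) - M * t) ^ 2 = M * t * (1 - t) := by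
  have h := congrArg (Polynomial.eval t) (bernsteinPolynomial.variance ℝ M)
  simp only [Polynomial.eval_finsetSum, Polynomial.eval_mul, Polynomial.eval_pow,
    Polynomial.eval_sub, ← binom_eq_eval, Polynomial.eval_X, nsmul_eq_mul,
    Polynomial.eval_natCast, Polynomial.eval_one] at h
  rw [← h]
  exact Finset.sum_congr rfl fun j _ => by ring

/-- The mean absolute deviation of a binomial variable is at most its standard deviation. -/
lemma sum_binom_mul_abs_le (M : ℕ) {t : ℝ} (ht : t ∈ Set.Icc (0 : ℝ) 1) :
    ∑ j ∈ Finset.range (M + 1), binom M j t * |(j : ℝ) - M * t| ≤ √(M * t * (1 - t)) := by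
  refine Real.le_sqrt_of_sq_le ?_
  rw [← sum_binom_mul_sq]
  have h := Finset.sum_sq_le_sum_mul_sum_of_sq_le_mul (Finset.range (M + 1))
    (r := fun j => binom M j t * |(j : ℝ) - M * t|) (f := fun j => binom M j t)
    (g := fun j => binom M j t * ((j : ℝ) - M * t) ^ 2)
    (fun j _ => binom_nonneg M j ht) (fun j _ => mul_nonneg (binom_nonneg M j ht) (sq_nonneg _))
    (fun j _ => le_of_eq (by rw [mul_pow, sq_abs]; ring))
  rwa [sum_binom, one_mul] at h

/-- The increments of the binomial weights, from the derivative of the weights in `t`. -/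
lemma binom_sub_binom_succ (M j : ℕ) (t : ℝ) :
    (M + 1) * (t * (1 - t)) * (binom M j t - binom M (j + 1) t) =
      binom (M + 1) (j + 1) t * ((j + 1 : ℕ) - (M + 1 : ℕ) * t) := by
  rcases lt_trichotomy M j with h | rfl | h
  · rw [binom_eq_zero h, binom_eq_zero (by omega), binom_eq_zero (by omega)]; ring
  · rw [binom_eq_zero (Nat.lt_succ_self M)]
    simp only [binom, Nat.choose_self, Nat.sub_self]
    push_cast; ring
  · obtain ⟨r, rfl⟩ := Nat.exists_eq_add_of_lt h
    have h1 : ((j + r + 1 + 1).choose (j + 1) : ℝ) * (j + 1) =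
        (j + r + 1 + 1) * (j + r + 1).choose j := by
      exact_mod_cast (Nat.add_one_mul_choose_eq (j + r + 1) j).symm
    have h2 : ((j + r + 1 + 1).choose (j + 1) : ℝ) * (r + 1) =
        (j + r + 1 + 1) * (j + r + 1).choose (j + 1) := by
      have h := Nat.choose_mul_succ_eq (j + r + 1) (j + 1)
      rw [show j + r + 1 + 1 - (j + 1) = r + 1 by omega] at h
      have h' : ((j + r + 1).choose (j + 1) : ℝ) * (j + r + 1 + 1) =
        (j + r + 1 + 1).choose (j + 1) * (r + 1) := by exact_mod_cast h
      linarith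
    simp only [binom]
    rw [show j + r + 1 - j = r + 1 by omega, show j + r + 1 - (j + 1) = r by omega,
      show j + r + 1 + 1 - (j + 1) = r + 1 by omega]
    push_cast
    linear_combination (-t ^ (j + 1) * (1 - t) ^ (r + 1) * (1 - t)) * h1 +
      (t ^ (j + 1) * (1 - t) ^ (r + 1) * t) * h2

/-- Shifting the binomial distribution by one changes it little in total variation. -/
lemma sum_abs_binom_sub_le (M : ℕ) {t : ℝ} (ht : t ∈ Set.Ioo (0 : ℝ) 1) :
    ∑ j ∈ Finset.range (M + 1), |binom M (j + 1) t - binom M j t| ≤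
      1 / √((M + 1 : ℕ) * t * (1 - t)) := by
  have ht' : t ∈ Set.Icc (0 : ℝ) 1 := ⟨ht.1.le, ht.2.le⟩
  have hc : 0 < ((M + 1 : ℕ) : ℝ) * t * (1 - t) :=
    mul_pos (mul_pos (by positivity) ht.1) (sub_pos.2 ht.2)
  have hj : ∀ j, |binom M (j + 1) t - binom M j t| =
      (((M + 1 : ℕ) : ℝ) * t * (1 - t))⁻¹ *
        (binom (M + 1) (j + 1) t * |((j + 1 : ℕ) : ℝ) - (M + 1 : ℕ) * t|) := by
    intro j
    rw [eq_inv_mul_iff_mul_eq₀ hc.ne']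
    calc _ = |(M + 1) * (t * (1 - t)) * (binom M j t - binom M (j + 1) t)| := by
          rw [abs_sub_comm, abs_mul _ (binom M j t - _),
            abs_of_nonneg (a := ((M : ℝ) + 1) * (t * (1 - t)))]
          · push_cast; ring
          · have := sub_nonneg.2 ht'.2
            have := ht'.1
            positivity
      _ = _ := by
          rw [binom_sub_binom_succ, abs_mul, abs_of_nonneg (binom_nonneg (M + 1) (j + 1) ht')]
  rw [Finset.sum_congr rfl fun j _ => hj j, ← Finset.mul_sum]
  have h := sum_binom_mul_abs_le (M + 1) ht'
  rw [Finset.sum_range_succ'] at h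
  have h0 := mul_nonneg (binom_nonneg (M + 1) 0 ht') (abs_nonneg (((0 : ℕ) : ℝ) - (M + 1 : ℕ) * t))
  calc _ ≤ (((M + 1 : ℕ) : ℝ) * t * (1 - t))⁻¹ * √(((M + 1 : ℕ) : ℝ) * t * (1 - t)) := by
        gcongr; linarith
    _ = _ := by
        rw [one_div, eq_comm, inv_eq_iff_eq_inv, mul_inv, inv_inv, ← div_eq_mul_inv,
          Real.div_sqrt]

/-- The variation of the binomial weights over the window `S, …, S + m`. -/
noncomputable def windowVar (m M S : ℕ) (t : ℝ) : ℝ :=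
  ∑ i ∈ Finset.range m, |binom M (S + i + 1) t - binom M (S + i) t|

lemma windowVar_nonneg (m M S : ℕ) (t : ℝ) : 0 ≤ windowVar m M S t :=
  Finset.sum_nonneg fun _ _ => abs_nonneg _

lemma continuous_windowVar (m M S : ℕ) : Continuous (windowVar m M S) :=
  continuous_finsetSum _ fun _ _ => ((continuous_binom _ _).sub (continuous_binom _ _)).abs

lemma abs_binom_sub_le_windowVar {m a b : ℕ} (ha : a ≤ m) (hb : b ≤ m) (M S : ℕ) (t : ℝ) :
    |binom M (S + a) t - binom M (S + b) t| ≤ windowVar m M S t := by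
  wlog hab : a ≤ b generalizing a b
  · rw [abs_sub_comm]; exact this hb ha (by omega)
  have h := dist_le_Ico_sum_dist (fun i => binom M (S + i) t) hab
  rw [Real.dist_eq] at h
  refine h.trans ?_
  refine (Finset.sum_le_sum_of_subset_of_nonneg (t := Finset.range m) (fun i hi => ?_)
    fun _ _ _ => dist_nonneg).trans (le_of_eq ?_)
  · rw [Finset.mem_Ico] at hi; exact Finset.mem_range.2 (by omega)
  · exact Finset.sum_congr rfl fun i _ => by rw [Real.dist_eq, abs_sub_comm]; rfl

lemma sum_windowVar_le (m N : ℕ) {t : ℝ} (ht : t ∈ Set.Ioo (0 : ℝ) 1) :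
    ∑ S ∈ Finset.range (N + 1 + 1), windowVar m (N + m) S t ≤
      m * (1 / √((N + m + 1 : ℕ) * t * (1 - t))) := by
  unfold windowVar
  rw [Finset.sum_comm]
  have : ∀ i ∈ Finset.range m, ∑ S ∈ Finset.range (N + 1 + 1),
      |binom (N + m) (S + i + 1) t - binom (N + m) (S + i) t| ≤
        1 / √((N + m + 1 : ℕ) * t * (1 - t)) := by
    intro i hi
    rw [Finset.mem_range] at hi
    refine le_trans ?_ (sum_abs_binom_sub_le (N + m) ht)
    have hinj : Set.InjOn (fun S => S + i) (Finset.range (N + 1 + 1) : Set ℕ) :=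
      fun _ _ _ _ h => by simpa using h
    rw [← Finset.sum_image (f := fun j => |binom (N + m) (j + 1) t - binom (N + m) j t|) hinj]
    refine Finset.sum_le_sum_of_subset_of_nonneg (fun j hj => ?_) fun _ _ _ => abs_nonneg _
    obtain ⟨S, hS, rfl⟩ := Finset.mem_image.1 hj
    rw [Finset.mem_range] at hS ⊢
    omega
  simpa using Finset.sum_le_sum this

/-! ### The estimated ratio of allocation slopes -/

/-- The coefficient in `binom m a * binom N S = mergeCoeff m N a S * binom (N + m) (S + a)`. -/
noncomputable def mergeCoeff (m N a S : ℕ) : ℝ :=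
  (m.choose a : ℝ) * N.choose S / (N + m).choose (S + a)

lemma mergeCoeff_nonneg (m N a S : ℕ) : 0 ≤ mergeCoeff m N a S := by
  unfold mergeCoeff; positivity

lemma mergeCoeff_pos {m N a S : ℕ} (ha : a ≤ m) (hS : S ≤ N) : 0 < mergeCoeff m N a S := by
  have h1 := Nat.choose_pos ha
  have h2 := Nat.choose_pos hS
  have h3 := Nat.choose_pos (show S + a ≤ N + m by omega)
  unfold mergeCoeff; positivity

lemma mergeCoeff_le_one (m N a S : ℕ) : mergeCoeff m N a S ≤ 1 := by
  refine div_le_one_of_le₀ ?_ (Nat.cast_nonneg _)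
  have h : N.choose S * m.choose a ≤ (N + m).choose (S + a) := by
    rw [Nat.add_choose_eq]
    exact Finset.single_le_sum (f := fun ij : ℕ × ℕ => N.choose ij.1 * m.choose ij.2)
      (fun _ _ => Nat.zero_le _) (a := (S, a)) (by simp)
  rw [mul_comm]; exact_mod_cast h

lemma binom_mul_binom {m N a S : ℕ} (ha : a ≤ m) (hS : S ≤ N) (t : ℝ) :
    binom m a t * binom N S t = mergeCoeff m N a S * binom (N + m) (S + a) t := by
  have h3 : ((N + m).choose (S + a) : ℝ) ≠ 0 :=
    Nat.cast_ne_zero.2 (Nat.choose_pos (show S + a ≤ N + m by omega)).ne'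
  unfold binom mergeCoeff
  rw [show N + m - (S + a) = (N - S) + (m - a) by omega, pow_add, pow_add]
  field_simp

lemma binom_succ_mul {N S : ℕ} (hS : S ≤ N) (t : ℝ) :
    binom (N + 1) S t * (1 - S / (N + 1 : ℕ)) = (1 - t) * binom N S t := by
  obtain ⟨r, rfl⟩ := Nat.exists_eq_add_of_le hS
  have h := Nat.choose_mul_succ_eq (S + r) S
  rw [show S + r + 1 - S = r + 1 by omega] at h
  have h' : ((S + r).choose S : ℝ) * (S + r + 1) = (S + r + 1).choose S * (r + 1) := by
    exact_mod_cast h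
  have hne : ((S : ℝ) + r + 1) ≠ 0 := by positivity
  unfold binom
  rw [show S + r + 1 - S = r + 1 by omega, show S + r - S = r by omega]
  push_cast
  field_simp
  linear_combination (-t ^ S * (1 - t) ^ (r + 1)) * h'

/-- The estimate, after `S` of `N + 1` sampled quantiles fell below `t`, of the ratio
`(1 - t) * binom m a t / ∑ j, d j * binom m j t`. Each `binom m j t` is replaced by the coefficient
that turns its product with `binom N S t` into a single binomial weight. -/
noncomputable def ratioEst (m N : ℕ) (d : ℕ → ℝ) (a S : ℕ) : ℝ :=
  (1 - S / (N + 1 : ℕ)) *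
    (mergeCoeff m N a S / ∑ j ∈ Finset.range (m + 1), d j * mergeCoeff m N j S)

lemma ratioEst_last (m N : ℕ) (d : ℕ → ℝ) (a : ℕ) : ratioEst m N d a (N + 1) = 0 := by
  have : ((N + 1 : ℕ) : ℝ) ≠ 0 := by positivity
  simp only [ratioEst, div_self this, sub_self, zero_mul]

/-- The merged products express the error of the ratio estimate as `mergeCoeff ≤ 1` times an
average, with weights `d j * mergeCoeff m N j S`, of differences of binomial weights within one
window. -/
lemma abs_weighted_sub_le_windowVar {m N a S : ℕ} {d : ℕ → ℝ} (hd : ∀ j ≤ m, 0 ≤ d j)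
    (hpos : ∃ j ≤ m, 0 < d j) (ha : a ≤ m) (hS : S ≤ N) (t : ℝ) :
    |mergeCoeff m N a S / (∑ j ∈ Finset.range (m + 1), d j * mergeCoeff m N j S) *
        (∑ j ∈ Finset.range (m + 1), d j * binom m j t) * binom N S t -
      binom m a t * binom N S t| ≤ windowVar m (N + m) S t := by
  set D := ∑ j ∈ Finset.range (m + 1), d j * mergeCoeff m N j S with hD
  have hDpos : 0 < D := by
    obtain ⟨j, hj, hdj⟩ := hpos
    refine Finset.sum_pos' (fun i hi => mul_nonneg (hd i ?_) (mergeCoeff_nonneg _ _ _ _))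
      ⟨j, Finset.mem_range.2 (by omega), mul_pos hdj (mergeCoeff_pos hj hS)⟩
    rw [Finset.mem_range] at hi; omega
  set p := fun j => binom (N + m) (S + j) t with hp
  have e1 : mergeCoeff m N a S / D * (∑ j ∈ Finset.range (m + 1), d j * binom m j t) *
      binom N S t - binom m a t * binom N S t =
      mergeCoeff m N a S / D *
        ∑ j ∈ Finset.range (m + 1), d j * mergeCoeff m N j S * (p j - p a) := by
    have e2 : (∑ j ∈ Finset.range (m + 1), d j * binom m j t) * binom N S t =
        ∑ j ∈ Finset.range (m + 1), d j * mergeCoeff m N j S * p j := by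
      rw [Finset.sum_mul]
      refine Finset.sum_congr rfl fun j hj => ?_
      rw [Finset.mem_range] at hj
      rw [mul_assoc, binom_mul_binom (by omega) hS, mul_assoc]
    simp only [mul_sub, Finset.sum_sub_distrib]
    rw [mul_assoc, e2, binom_mul_binom ha hS, ← Finset.sum_mul, ← hD]
    field_simp
    simp [hp]
  rw [e1, abs_mul, abs_of_nonneg (div_nonneg (mergeCoeff_nonneg _ _ _ _) hDpos.le)]
  calc _ ≤ mergeCoeff m N a S / D *
        ∑ j ∈ Finset.range (m + 1), d j * mergeCoeff m N j S * windowVar m (N + m) S t := by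
        refine mul_le_mul_of_nonneg_left ?_ (div_nonneg (mergeCoeff_nonneg _ _ _ _) hDpos.le)
        refine (Finset.abs_sum_le_sum_abs _ _).trans (Finset.sum_le_sum fun j hj => ?_)
        rw [Finset.mem_range] at hj
        have hw : 0 ≤ d j * mergeCoeff m N j S :=
          mul_nonneg (hd j (by omega)) (mergeCoeff_nonneg _ _ _ _)
        rw [abs_mul, abs_of_nonneg hw]
        exact mul_le_mul_of_nonneg_left (abs_binom_sub_le_windowVar (by omega) ha _ _ _) hw
    _ = mergeCoeff m N a S * windowVar m (N + m) S t := by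
        rw [← Finset.sum_mul, ← hD]; field_simp
    _ ≤ _ := mul_le_of_le_one_left (windowVar_nonneg _ _ _ _) (mergeCoeff_le_one _ _ _ _)

/-- A bound, uniform in `a` and `d`, for the error at `t` of the estimates `ratioEst m N d a S`. -/
noncomputable def errBound (m N S : ℕ) (t : ℝ) : ℝ :=
  (m + 1) * ((1 - t) * windowVar m (N + m) S t / binom (N + 1) S t + |S / (N + 1 : ℕ) - t|)

lemma abs_slope_mul_ratioEst_sub_le {m N a S : ℕ} {d : ℕ → ℝ} (hd : ∀ j ≤ m, 0 ≤ d j)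
    (hpos : ∃ j ≤ m, 0 < d j) (ha : a ≤ m) (hS : S ≤ N + 1) {t : ℝ}
    (ht : t ∈ Set.Ioo (0 : ℝ) 1) :
    |(m + 1) * (∑ j ∈ Finset.range (m + 1), d j * binom m j t) * ratioEst m N d a S -
      (1 - t) * ((m + 1) * binom m a t)| ≤ errBound m N S t := by
  have ht' : t ∈ Set.Icc (0 : ℝ) 1 := ⟨ht.1.le, ht.2.le⟩
  have hB := binom_pos hS ht
  set G := ∑ j ∈ Finset.range (m + 1), d j * binom m j t
  set z := mergeCoeff m N a S / (∑ j ∈ Finset.range (m + 1), d j * mergeCoeff m N j S) with hz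
  have h1t : 0 ≤ 1 - t := sub_nonneg.2 ht'.2
  -- The first part replaces the ratio by its estimate, the second the factor `1 - t` by
  -- `1 - S / (N + 1)`.
  have key : binom (N + 1) S t * |G * ratioEst m N d a S - (1 - t) * binom m a t| ≤
      (1 - t) * windowVar m (N + m) S t + binom (N + 1) S t * |S / (N + 1 : ℕ) - t| := by
    have hlast : binom m a t * (binom (N + 1) S t * |S / (N + 1 : ℕ) - t|) ≤
        binom (N + 1) S t * |S / (N + 1 : ℕ) - t| :=
      mul_le_of_le_one_left (mul_nonneg hB.le (abs_nonneg _)) (binom_le_one m a ht')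
    have hfac : binom (N + 1) S t * |G * ratioEst m N d a S - (1 - t) * binom m a t| =
        |G * z * (binom (N + 1) S t * (1 - S / (N + 1 : ℕ))) -
          (1 - t) * binom m a t * binom (N + 1) S t| := by
      rw [← abs_of_pos hB, ← abs_mul, abs_of_pos hB]
      congr 1; rw [ratioEst, ← hz]; ring
    rw [hfac]
    have habs : |binom m a t * (binom (N + 1) S t * (1 - S / (N + 1 : ℕ)) -
        (1 - t) * binom (N + 1) S t)| ≤ binom (N + 1) S t * |S / (N + 1 : ℕ) - t| := by
      rw [show binom (N + 1) S t * (1 - S / (N + 1 : ℕ)) - (1 - t) * binom (N + 1) S t =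
        binom (N + 1) S t * (t - S / (N + 1 : ℕ)) by ring, abs_mul, abs_mul, abs_of_pos hB,
        abs_of_nonneg (binom_nonneg m a ht'), abs_sub_comm]
      exact hlast
    have hmain : |G * z * (binom (N + 1) S t * (1 - S / (N + 1 : ℕ))) -
        binom m a t * (binom (N + 1) S t * (1 - S / (N + 1 : ℕ)))| ≤
          (1 - t) * windowVar m (N + m) S t := by
      rcases Nat.lt_or_ge N S with h | h
      · -- For `S = N + 1` the factor `1 - S / (N + 1)` is zero.
        obtain rfl : S = N + 1 := by omega
        have : ((N + 1 : ℕ) : ℝ) ≠ 0 := by positivity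
        rw [div_self this]
        simpa using mul_nonneg h1t (windowVar_nonneg m (N + m) (N + 1) t)
      · rw [binom_succ_mul h, show G * z * ((1 - t) * binom N S t) -
          binom m a t * ((1 - t) * binom N S t) =
          (1 - t) * (z * G * binom N S t - binom m a t * binom N S t) by ring, abs_mul,
          abs_of_nonneg h1t]
        exact mul_le_mul_of_nonneg_left (abs_weighted_sub_le_windowVar hd hpos ha h t) h1t
    calc _ = |(G * z * (binom (N + 1) S t * (1 - S / (N + 1 : ℕ))) -
          binom m a t * (binom (N + 1) S t * (1 - S / (N + 1 : ℕ)))) +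
          binom m a t * (binom (N + 1) S t * (1 - S / (N + 1 : ℕ)) -
            (1 - t) * binom (N + 1) S t)| := by congr 1; ring
      _ ≤ _ := (abs_add_le _ _).trans (add_le_add hmain habs)
  have hm : (0 : ℝ) ≤ m + 1 := by positivity
  rw [show (m + 1) * G * ratioEst m N d a S - (1 - t) * ((m + 1) * binom m a t) =
    (m + 1) * (G * ratioEst m N d a S - (1 - t) * binom m a t) by ring, abs_mul,
    abs_of_nonneg hm, errBound]
  refine mul_le_mul_of_nonneg_left ?_ hm
  rw [← mul_le_mul_iff_right₀ hB, mul_add, mul_div_cancel₀ _ hB.ne']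
  exact key

lemma errBound_nonneg {m N S : ℕ} {t : ℝ} (ht : t ∈ Set.Icc (0 : ℝ) 1) : 0 ≤ errBound m N S t := by
  have := windowVar_nonneg m (N + m) S t
  have := binom_nonneg (N + 1) S ht
  have := sub_nonneg.2 ht.2
  unfold errBound; positivity

lemma measurable_errBound (m N S : ℕ) : Measurable (errBound m N S) := by
  have := (continuous_windowVar m (N + m) S).measurable
  have := (continuous_binom (N + 1) S).measurable
  unfold errBound; fun_prop

/-- The expected error at `t`, for a binomial number `S` of sampled quantiles below `t`. -/
lemma sum_binom_mul_errBound_le (m N : ℕ) {t : ℝ} (ht : t ∈ Set.Ioo (0 : ℝ) 1) :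
    ∑ S ∈ Finset.range (N + 1 + 1), binom (N + 1) S t * errBound m N S t ≤
      (m + 1) / √(N + 1 : ℕ) * (m * t ^ (-(1 / 2) : ℝ) + 1) := by
  have ht' : t ∈ Set.Icc (0 : ℝ) 1 := ⟨ht.1.le, ht.2.le⟩
  have h1t : 0 < 1 - t := sub_pos.2 ht.2
  have hN : (0 : ℝ) < (N + 1 : ℕ) := by positivity
  have hsN := Real.sqrt_pos.2 hN
  have e : ∀ S ∈ Finset.range (N + 1 + 1), binom (N + 1) S t * errBound m N S t =
      (m + 1) * ((1 - t) * windowVar m (N + m) S t +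
        ((N + 1 : ℕ) : ℝ)⁻¹ * (binom (N + 1) S t * |S - (N + 1 : ℕ) * t|)) := by
    intro S hS
    rw [Finset.mem_range] at hS
    have hB := binom_pos (show S ≤ N + 1 by omega) ht
    have : |(S : ℝ) / (N + 1 : ℕ) - t| = ((N + 1 : ℕ) : ℝ)⁻¹ * |S - (N + 1 : ℕ) * t| := by
      rw [show (S : ℝ) / (N + 1 : ℕ) - t = ((N + 1 : ℕ) : ℝ)⁻¹ * (S - (N + 1 : ℕ) * t) by
        rw [mul_sub, inv_mul_cancel_left₀ hN.ne', div_eq_inv_mul], abs_mul,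
        abs_of_pos (inv_pos.2 hN)]
    rw [errBound, this]
    field_simp
  rw [Finset.sum_congr rfl e, ← Finset.mul_sum, Finset.sum_add_distrib, ← Finset.mul_sum,
    ← Finset.mul_sum, div_mul_eq_mul_div, mul_div_assoc]
  refine mul_le_mul_of_nonneg_left ?_ (by positivity)
  have hA : (1 - t) * ∑ S ∈ Finset.range (N + 1 + 1), windowVar m (N + m) S t ≤
      m * t ^ (-(1 / 2) : ℝ) / √(N + 1 : ℕ) := by
    have h1 : 1 / √((N + m + 1 : ℕ) * t * (1 - t)) ≤ 1 / √((N + 1 : ℕ) * t * (1 - t)) := by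
      have : (0 : ℝ) < (N + 1 : ℕ) * t * (1 - t) := mul_pos (mul_pos hN ht.1) h1t
      gcongr 1 / √(?_ * t * (1 - t))
      · exact ht.1.le
      · exact_mod_cast (by omega : N + 1 ≤ N + m + 1)
    calc _ ≤ (1 - t) * (m * (1 / √((N + 1 : ℕ) * t * (1 - t)))) := by
          gcongr
          exact (sum_windowVar_le m N ht).trans (by gcongr)
      _ = m * t ^ (-(1 / 2) : ℝ) / √(N + 1 : ℕ) * √(1 - t) := by
          rw [Real.rpow_neg ht.1.le, ← Real.sqrt_eq_rpow, Real.sqrt_mul (mul_nonneg hN.le ht.1.le),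
            Real.sqrt_mul hN.le]
          have := Real.sqrt_pos.2 ht.1
          have := Real.sqrt_pos.2 h1t
          field_simp
          rw [Real.sq_sqrt h1t.le]; ring
      _ ≤ _ := by
          refine mul_le_of_le_one_right ?_ (Real.sqrt_le_one.2 (by linarith [ht.1]))
          have := Real.rpow_nonneg ht.1.le (-(1 / 2))
          positivity
  have hC : ((N + 1 : ℕ) : ℝ)⁻¹ * ∑ S ∈ Finset.range (N + 1 + 1),
      binom (N + 1) S t * |(S : ℝ) - (N + 1 : ℕ) * t| ≤ 1 / √(N + 1 : ℕ) := by
    calc _ ≤ ((N + 1 : ℕ) : ℝ)⁻¹ * √((N + 1 : ℕ) * t * (1 - t)) := by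
          gcongr; exact sum_binom_mul_abs_le (N + 1) ht'
      _ ≤ ((N + 1 : ℕ) : ℝ)⁻¹ * √(N + 1 : ℕ) := by
          gcongr
          rw [mul_assoc]
          exact mul_le_of_le_one_right hN.le (by nlinarith [ht.1])
      _ = _ := by
          rw [inv_mul_eq_div, Real.sqrt_div_self', one_div]
  calc _ ≤ _ := add_le_add hA hC
    _ = _ := by ring

/-! ### The number of sampled quantiles in a set -/

lemma measurable_card_filter_mem (N : ℕ) {A : Set ℝ} [DecidablePred (· ∈ A)]
    (hA : MeasurableSet A) :
    Measurable fun u : Fin N → ℝ => (Finset.univ.filter fun i => u i ∈ A).card := by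
  simp only [Finset.card_filter]
  exact Finset.measurable_fun_sum _ fun i _ =>
    Measurable.ite (measurable_pi_apply i hA) measurable_const measurable_const

/-- Among `N` independent draws, the number that lands in `A` is binomial. -/
lemma pi_card_filter_mem_eq (N s : ℕ) (μ : Measure ℝ) [IsProbabilityMeasure μ] {A : Set ℝ}
    [DecidablePred (· ∈ A)] (hA : MeasurableSet A) :
    (Measure.pi fun _ : Fin N => μ)
        {u | (Finset.univ.filter fun i => u i ∈ A).card = s} =
      ENNReal.ofReal (binom N s (μ.real A)) := by
  classical
  have hset : {u : Fin N → ℝ | (Finset.univ.filter fun i => u i ∈ A).card = s} =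
      ⋃ T ∈ Finset.powersetCard s (Finset.univ : Finset (Fin N)),
        Set.univ.pi fun i => if i ∈ T then A else Aᶜ := by
    ext u
    simp only [Set.mem_ofPred_eq, Set.mem_iUnion, Finset.mem_powersetCard, Set.mem_univ_pi,
      exists_prop]
    constructor
    · refine fun h => ⟨_, ⟨Finset.subset_univ _, h⟩, fun i => ?_⟩
      by_cases hi : u i ∈ A <;> simp [hi]
    · rintro ⟨T, ⟨-, hT⟩, hu⟩
      rw [← hT]
      congr 1
      ext i
      have := hu i
      by_cases hi : i ∈ T <;> simp_all
  have hdisj : Set.PairwiseDisjoint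
      (Finset.powersetCard s (Finset.univ : Finset (Fin N)) : Set (Finset (Fin N)))
      fun T => Set.univ.pi fun i => if i ∈ T then A else Aᶜ := by
    intro T _ T' _ hne
    refine Set.disjoint_left.2 fun u hu hu' => hne ?_
    ext i
    have h1 := hu i (Set.mem_univ i)
    have h2 := hu' i (Set.mem_univ i)
    by_cases hi : i ∈ T <;> by_cases hi' : i ∈ T' <;> simp_all
  rw [hset, measure_biUnion_finset hdisj fun T _ => MeasurableSet.univ_pi fun i => by
    split_ifs; exacts [hA, hA.compl]]
  have hp : ∀ T ∈ Finset.powersetCard s (Finset.univ : Finset (Fin N)),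
      (Measure.pi fun _ : Fin N => μ) (Set.univ.pi fun i => if i ∈ T then A else Aᶜ) =
        ENNReal.ofReal (μ.real A ^ s * (1 - μ.real A) ^ (N - s)) := by
    intro T hT
    have hT' := (Finset.mem_powersetCard.1 hT).2
    rw [Measure.pi_pi]
    have : ∀ i, μ (if i ∈ T then A else Aᶜ) =
        if i ∈ T then ENNReal.ofReal (μ.real A) else ENNReal.ofReal (1 - μ.real A) := by
      intro i
      split_ifs
      · rw [ofReal_measureReal]
      · rw [← probReal_compl_eq_one_sub hA, ofReal_measureReal]
    simp only [this]
    rw [Finset.prod_ite, Finset.prod_const, Finset.prod_const, Finset.filter_mem_eq_inter,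
      Finset.univ_inter, hT', Finset.filter_not, Finset.filter_mem_eq_inter, Finset.univ_inter,
      ← Finset.compl_eq_univ_sdiff, Finset.card_compl, hT', Fintype.card_fin,
      ← ENNReal.ofReal_pow measureReal_nonneg, ← ENNReal.ofReal_pow, ← ENNReal.ofReal_mul]
    · exact pow_nonneg measureReal_nonneg _
    · exact sub_nonneg.2 measureReal_le_one
  rw [Finset.sum_congr rfl hp, Finset.sum_const, Finset.card_powersetCard, Finset.card_univ,
    Fintype.card_fin, nsmul_eq_mul, binom, mul_assoc, ENNReal.ofReal_mul (Nat.cast_nonneg _),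
    ENNReal.ofReal_natCast]

lemma apply_card_filter_eq_sum_indicator {R : Type*} [AddCommMonoid R] (N : ℕ) (A : Set ℝ)
    [DecidablePred (· ∈ A)] (f : ℕ → R) (u : Fin N → ℝ) :
    f (Finset.univ.filter fun i => u i ∈ A).card =
      ∑ s ∈ Finset.range (N + 1), Set.indicator
        {u : Fin N → ℝ | (Finset.univ.filter fun i => u i ∈ A).card = s} (fun _ => f s) u := by
  have hc : (Finset.univ.filter fun i => u i ∈ A).card ∈ Finset.range (N + 1) :=
    Finset.mem_range.2 (Nat.lt_succ_of_le ((Finset.card_le_univ _).trans_eq (Fintype.card_fin N)))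
  simp only [Set.indicator_apply, Set.mem_ofPred_eq]
  rw [Finset.sum_ite_eq, if_pos hc]

lemma lintegral_card_filter_mem (N : ℕ) (μ : Measure ℝ) [IsProbabilityMeasure μ] {A : Set ℝ}
    [DecidablePred (· ∈ A)] (hA : MeasurableSet A) (f : ℕ → ENNReal) :
    ∫⁻ u, f (Finset.univ.filter fun i => u i ∈ A).card ∂(Measure.pi fun _ : Fin N => μ) =
      ∑ s ∈ Finset.range (N + 1), f s * ENNReal.ofReal (binom N s (μ.real A)) := by
  have hm : ∀ s, MeasurableSet
      {u : Fin N → ℝ | (Finset.univ.filter fun i => u i ∈ A).card = s} :=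
    fun s => measurable_card_filter_mem N hA (measurableSet_singleton s)
  simp_rw [apply_card_filter_eq_sum_indicator N A f]
  rw [lintegral_finsetSum _ fun s _ => measurable_const.indicator (hm s)]
  refine Finset.sum_congr rfl fun s _ => ?_
  rw [lintegral_indicator_const (hm s), pi_card_filter_mem_eq N s μ hA]

lemma integral_card_filter_mem (N : ℕ) (μ : Measure ℝ) [IsProbabilityMeasure μ] {A : Set ℝ}
    [DecidablePred (· ∈ A)] (hA : MeasurableSet A) (f : ℕ → ℝ) :
    ∫ u, f (Finset.univ.filter fun i => u i ∈ A).card ∂(Measure.pi fun _ : Fin N => μ) =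
      ∑ s ∈ Finset.range (N + 1), f s * binom N s (μ.real A) := by
  have hm : ∀ s, MeasurableSet
      {u : Fin N → ℝ | (Finset.univ.filter fun i => u i ∈ A).card = s} :=
    fun s => measurable_card_filter_mem N hA (measurableSet_singleton s)
  simp_rw [apply_card_filter_eq_sum_indicator N A f]
  rw [integral_finsetSum _ fun s _ => (integrable_const _).indicator (hm s)]
  refine Finset.sum_congr rfl fun s _ => ?_
  rw [integral_indicator_const _ (hm s), measureReal_def,
    pi_card_filter_mem_eq N s μ hA, ENNReal.toReal_ofReal, smul_eq_mul, mul_comm]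
  exact binom_nonneg _ _ ⟨measureReal_nonneg, measureReal_le_one⟩

instance : IsProbabilityMeasure quantileLaw := ⟨by simp [quantileLaw]⟩

lemma quantileLaw_real_Iic {t : ℝ} (ht : t ∈ Set.Icc (0 : ℝ) 1) :
    quantileLaw.real (Set.Iic t) = t := by
  have : Set.Iic t ∩ Set.Icc 0 1 = Set.Icc 0 t := by
    ext x; simp only [Set.mem_inter_iff, Set.mem_Iic, Set.mem_Icc]
    exact ⟨fun h => ⟨h.2.1, h.1⟩, fun h => ⟨h.2, h.1, h.2.trans ht.2⟩⟩
  rw [measureReal_def, quantileLaw, Measure.restrict_apply measurableSet_Iic, this]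
  simp [ht.1]

lemma quantileLaw_real_Ioi {t : ℝ} (ht : t ∈ Set.Icc (0 : ℝ) 1) :
    quantileLaw.real (Set.Ioi t) = 1 - t := by
  rw [← Set.compl_Iic, probReal_compl_eq_one_sub measurableSet_Iic, quantileLaw_real_Iic ht]

lemma ae_quantile_mem_Ioc : ∀ᵐ q ∂quantileLaw, q ∈ Set.Ioc (0 : ℝ) 1 := by
  rw [quantileLaw, ← restrict_Ioc_eq_restrict_Icc]
  exact ae_restrict_mem measurableSet_Ioc

lemma ae_quantiles_mem_Ioc (N : ℕ) :
    ∀ᵐ u ∂(Measure.pi fun _ : Fin N => quantileLaw), ∀ i, u i ∈ Set.Ioc (0 : ℝ) 1 :=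
  ae_all_iff.2 fun i => 
    Measure.tendsto_eval_ae_ae (i := i) ae_quantile_mem_Ioc

/-! ### Allocation rules and their slopes -/

lemma hasDerivAt_binom_succ (M j : ℕ) (t : ℝ) :
    HasDerivAt (binom (M + 1) (j + 1)) ((M + 1) * (binom M j t - binom M (j + 1) t)) t := by
  have h := (bernsteinPolynomial ℝ (M + 1) (j + 1)).hasDerivAt t
  rw [bernsteinPolynomial.derivative_succ] at h
  simpa [binom_eq_eval, funext (binom_eq_eval (M + 1) (j + 1))] using h

lemma hasDerivAt_binom_zero (M : ℕ) (t : ℝ) :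
    HasDerivAt (binom (M + 1) 0) (-(M + 1) * binom M 0 t) t := by
  have h := (bernsteinPolynomial ℝ (M + 1) 0).hasDerivAt t
  rw [bernsteinPolynomial.derivative_zero] at h
  simpa [binom_eq_eval, funext (binom_eq_eval (M + 1) 0)] using h

/-- The marginal weight `w k - w (k + 1)` of the position `k = m + 1 - a` among `m + 2` agents. -/
def slopeCoeff (m : ℕ) (w : ℕ → ℝ) (a : ℕ) : ℝ := w (m + 1 - a) - w (m + 2 - a)

/-- The derivative of the allocation rule of `m + 2` agents. -/
noncomputable def allocSlope (m : ℕ) (w : ℕ → ℝ) (t : ℝ) : ℝ :=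
  (m + 1) * ∑ a ∈ Finset.range (m + 1), slopeCoeff m w a * binom m a t

lemma alloc_eq_sum_binom_one_sub (m : ℕ) (w : ℕ → ℝ) (q : ℝ) :
    alloc (m + 2) w q =
      ∑ s ∈ Finset.range (m + 2), w (1 + s) * binom (m + 1) s (1 - q) := by
  rw [alloc, ← Finset.Ico_add_one_right_eq_Icc, Finset.sum_Ico_eq_sum_range]
  refine Finset.sum_congr rfl fun s _ => ?_
  rw [show m + 2 - 1 = m + 1 by omega, show 1 + s - 1 = s by omega,
    show m + 2 - (1 + s) = m + 1 - s by omega, binom, sub_sub_cancel]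
  ring

lemma alloc_eq_sum_binom (m : ℕ) (w : ℕ → ℝ) (q : ℝ) :
    alloc (m + 2) w q = ∑ a ∈ Finset.range (m + 2), w (m + 2 - a) * binom (m + 1) a q := by
  rw [alloc_eq_sum_binom_one_sub, ← Finset.sum_range_reflect]
  refine Finset.sum_congr rfl fun a ha => ?_
  rw [Finset.mem_range] at ha
  rw [show 1 + (m + 2 - 1 - a) = m + 2 - a by omega, show m + 2 - 1 - a = m + 1 - a by omega,
    binom, binom, sub_sub_cancel, Nat.choose_symm (by omega : a ≤ m + 1),
    show m + 1 - (m + 1 - a) = a by omega]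
  ring

lemma hasDerivAt_alloc (m : ℕ) (w : ℕ → ℝ) (q : ℝ) :
    HasDerivAt (alloc (m + 2) w) (allocSlope m w q) q := by
  rw [funext (alloc_eq_sum_binom m w)]
  have h : HasDerivAt (fun q => ∑ a ∈ Finset.range (m + 2), w (m + 2 - a) * binom (m + 1) a q)
      (∑ a ∈ Finset.range (m + 1), w (m + 2 - (a + 1)) *
        ((m + 1) * (binom m a q - binom m (a + 1) q)) +
          w (m + 2 - 0) * (-(m + 1) * binom m 0 q)) q := by
    simp only [Finset.sum_range_succ' _ (m + 1)]
    exact (HasDerivAt.fun_sum fun a _ => (hasDerivAt_binom_succ m a q).const_mul _).add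
      ((hasDerivAt_binom_zero m q).const_mul _)
  convert h using 1
  have h0 : ∑ a ∈ Finset.range (m + 1), w (m + 2 - a) * binom m a q =
      ∑ a ∈ Finset.range (m + 1), w (m + 2 - (a + 1)) * binom m (a + 1) q +
        w (m + 2 - 0) * binom m 0 q := by
    rw [← Finset.sum_range_succ' (fun a => w (m + 2 - a) * binom m a q) (m + 1),
      Finset.sum_range_succ _ (m + 1), binom_eq_zero (Nat.lt_succ_self m), mul_zero, add_zero]
  simp only [allocSlope, slopeCoeff, sub_mul, Finset.sum_sub_distrib]
  rw [h0]
  simp only [mul_sub, Finset.sum_sub_distrib, mul_left_comm _ ((m : ℝ) + 1), ← Finset.mul_sum]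
  simp only [show ∀ a, m + 2 - (a + 1) = m + 1 - a by omega]
  ring

lemma continuous_allocSlope (m : ℕ) (w : ℕ → ℝ) : Continuous (allocSlope m w) :=
  continuous_const.mul <| continuous_finsetSum _ fun _ _ =>
    continuous_const.mul (continuous_binom _ _)

lemma IsPositionWeights.slopeCoeff_nonneg {m : ℕ} {w : ℕ → ℝ} (hw : IsPositionWeights (m + 2) w)
    {a : ℕ} (ha : a ≤ m) : 0 ≤ slopeCoeff m w a :=
  sub_nonneg.2 (hw.antitone ⟨by omega, by omega⟩ ⟨by omega, by omega⟩ (by omega))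

lemma IsPositionWeights.slopeCoeff_le_one {m : ℕ} {w : ℕ → ℝ} (hw : IsPositionWeights (m + 2) w)
    {a : ℕ} (ha : a ≤ m) : slopeCoeff m w a ≤ 1 := by
  have h1 := (hw.mem_unit (m + 1 - a) ⟨by omega, by omega⟩).2
  have h2 := (hw.mem_unit (m + 2 - a) ⟨by omega, by omega⟩).1
  unfold slopeCoeff; linarith

lemma IsPositionWeights.allocSlope_mem {m : ℕ} {w : ℕ → ℝ} (hw : IsPositionWeights (m + 2) w)
    {t : ℝ} (ht : t ∈ Set.Icc (0 : ℝ) 1) : allocSlope m w t ∈ Set.Icc (0 : ℝ) (m + 1) := by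
  have ha : ∀ a ∈ Finset.range (m + 1), a ≤ m := fun a ha => by
    rw [Finset.mem_range] at ha; omega
  constructor
  · exact mul_nonneg (by positivity) (Finset.sum_nonneg fun a h =>
      mul_nonneg (hw.slopeCoeff_nonneg (ha a h)) (binom_nonneg _ _ ht))
  · refine mul_le_of_le_one_right (by positivity) ?_
    rw [← sum_binom m t]
    exact Finset.sum_le_sum fun a h =>
      mul_le_of_le_one_left (binom_nonneg _ _ ht) (hw.slopeCoeff_le_one (ha a h))

/-! ### Equilibrium bids -/

lemma serviceProb_bid (m : ℕ) (w : ℕ → ℝ) {b : ℝ → ℝ} (hb : StrictMonoOn b (Set.Icc 0 1))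
    {q : ℝ} (hq : q ∈ Set.Icc (0 : ℝ) 1) :
    serviceProb (m + 2) w b (b q) = alloc (m + 2) w q := by
  have h : serviceProb (m + 2) w b (b q) =
      ∫ u : Fin (m + 1) → ℝ, w (1 + (Finset.univ.filter fun i => u i ∈ Set.Ioi q).card)
        ∂(Measure.pi fun _ => quantileLaw) := by
    refine integral_congr_ae ?_
    filter_upwards [ae_quantiles_mem_Ioc (m + 1)] with u hu
    congr 3
    refine Finset.filter_congr fun i _ => ?_
    exact hb.lt_iff_lt hq (Set.Ioc_subset_Icc_self (hu i))
  rw [h, integral_card_filter_mem (m + 1) quantileLaw measurableSet_Ioi fun s => w (1 + s),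
    quantileLaw_real_Ioi hq, alloc_eq_sum_binom_one_sub]

lemma serviceProb_zero (m : ℕ) (w : ℕ → ℝ) {b : ℝ → ℝ} (hb : StrictMonoOn b (Set.Icc 0 1))
    (hb0 : 0 ≤ b 0) : serviceProb (m + 2) w b 0 = serviceProb (m + 2) w b (b 0) := by
  refine integral_congr_ae ?_
  filter_upwards [ae_quantiles_mem_Ioc (m + 1)] with u hu
  congr 3
  refine Finset.filter_congr fun i _ => ?_
  have h : b 0 < b (u i) :=
    hb (Set.left_mem_Icc.2 zero_le_one) (Set.Ioc_subset_Icc_self (hu i)) (hu i).1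
  exact iff_of_true (hb0.trans_lt h) h

/-- If every increment of `f` is bounded by a product of increments of `x` and of a bounded
monotone `v`, then `f` is constant: over a uniform partition into `M` parts the bounds add up to
at most `L / M`. -/
lemma eq_of_abs_sub_le_mul_sub {f v : ℝ → ℝ} {L : ℝ} (hL : 0 ≤ L) (hv : IsValueFunction v)
    (h : ∀ x ∈ Set.Icc (0 : ℝ) 1, ∀ y ∈ Set.Icc (0 : ℝ) 1, x ≤ y →
      |f y - f x| ≤ L * (y - x) * (v y - v x)) {q : ℝ} (hq : q ∈ Set.Icc (0 : ℝ) 1) :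
    f q = f 0 := by
  have hM : ∀ M : ℕ, 0 < M → |f q - f 0| ≤ L / M := by
    intro M hM
    have hM' : (0 : ℝ) < M := Nat.cast_pos.2 hM
    have hmem : ∀ i : ℕ, i ≤ M → (i : ℝ) * (q / M) ∈ Set.Icc (0 : ℝ) 1 := by
      intro i hi
      have hi' : (i : ℝ) ≤ M := Nat.cast_le.2 hi
      refine ⟨by have := hq.1; positivity, ?_⟩
      calc (i : ℝ) * (q / M) ≤ M * (q / M) := by have := hq.1; gcongr
        _ = q := by field_simp
        _ ≤ 1 := hq.2
    have h1 := dist_le_range_sum_dist (fun i : ℕ => f (i * (q / M))) M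
    have h2 : ∑ i ∈ Finset.range M, dist (f ((i : ℕ) * (q / M))) (f ((i + 1 : ℕ) * (q / M))) ≤
        ∑ i ∈ Finset.range M,
          L * (q / M) * (v ((i + 1 : ℕ) * (q / M)) - v ((i : ℕ) * (q / M))) := by
      refine Finset.sum_le_sum fun i hi => ?_
      rw [Finset.mem_range] at hi
      rw [dist_comm, Real.dist_eq]
      refine (h _ (hmem i hi.le) _ (hmem (i + 1) hi) ?_).trans_eq ?_
      · have : 0 ≤ q / M := div_nonneg hq.1 hM'.le
        push_cast; nlinarith
      · push_cast; ring
    rw [← Finset.mul_sum, Finset.sum_range_sub (fun i : ℕ => v (i * (q / M)))] at h2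
    have h3 : ((M : ℕ) : ℝ) * (q / M) = q := by field_simp
    rw [dist_comm, Real.dist_eq] at h1
    simp only [h3, Nat.cast_zero, zero_mul] at h1 h2
    refine h1.trans (h2.trans ?_)
    have hv1 := (hv.mem_unit q hq).2
    have hv0 := (hv.mem_unit 0 (Set.left_mem_Icc.2 zero_le_one)).1
    calc L * (q / M) * (v q - v 0) ≤ L * (1 / M) * 1 := by
          have := hq.1
          have := hq.2
          have := sub_nonneg.2 (hv.monotone (Set.left_mem_Icc.2 zero_le_one) hq hq.1)
          gcongr
          linarith
      _ = L / M := by ring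
  by_contra hne
  have hpos : 0 < |f q - f 0| := abs_pos.2 (sub_ne_zero.2 hne)
  obtain ⟨M, hM'⟩ := exists_nat_gt (L / |f q - f 0|)
  have hMpos : (0 : ℝ) < M := (div_nonneg hL hpos.le).trans_lt hM'
  have := hM M (Nat.cast_pos.1 hMpos)
  rw [div_lt_iff₀ hpos] at hM'
  rw [le_div_iff₀ hMpos] at this
  linarith

lemma IsValueFunction.intervalIntegrable_mul {v g : ℝ → ℝ} (hv : IsValueFunction v)
    (hg : Continuous g) {x y : ℝ} (hx : x ∈ Set.Icc (0 : ℝ) 1) (hy : y ∈ Set.Icc (0 : ℝ) 1) :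
    IntervalIntegrable (fun t => v t * g t) volume x y := by
  have h : MonotoneOn v (Set.uIcc x y) := hv.monotone.mono (Set.uIcc_subset_Icc hx hy)
  exact h.intervalIntegrable.mul_continuousOn hg.continuousOn

/-- The payment identity of the all-pay auction. -/
lemma IsAllPayEquilibrium.bid_eq_integral {m : ℕ} {w : ℕ → ℝ} {v b : ℝ → ℝ}
    (hw : IsPositionWeights (m + 2) w) (hv : IsValueFunction v)
    (hb : IsAllPayEquilibrium (m + 2) w v b) {q : ℝ} (hq : q ∈ Set.Icc (0 : ℝ) 1) :
    b q = ∫ t in (0 : ℝ)..q, v t * allocSlope m w t := by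
  have h0 : (0 : ℝ) ∈ Set.Icc (0 : ℝ) 1 := Set.left_mem_Icc.2 zero_le_one
  -- A positive lowest bid would lose against the bid `0`, which wins equally often.
  have hb0 : b 0 = 0 := by
    refine le_antisymm ?_ (hb.nonneg 0 h0)
    have := hb.bestResponse 0 h0 0 le_rfl
    rw [serviceProb_zero m w hb.strictMono (hb.nonneg 0 h0)] at this
    linarith
  have hbr : ∀ x ∈ Set.Icc (0 : ℝ) 1, ∀ y ∈ Set.Icc (0 : ℝ) 1,
      v x * alloc (m + 2) w y - b y ≤ v x * alloc (m + 2) w x - b x := by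
    intro x hx y hy
    have := hb.bestResponse x hx (b y) (hb.nonneg y hy)
    rwa [serviceProb_bid m w hb.strictMono hx, serviceProb_bid m w hb.strictMono hy] at this
  have hgi : ∀ x y, IntervalIntegrable (allocSlope m w) volume x y :=
    fun x y => (continuous_allocSlope m w).intervalIntegrable x y
  have hX : ∀ x y, ∫ t in x..y, allocSlope m w t = alloc (m + 2) w y - alloc (m + 2) w x :=
    fun x y => intervalIntegral.integral_eq_sub_of_hasDerivAt
      (fun t _ => hasDerivAt_alloc m w t) (hgi x y)
  set I : ℝ → ℝ := fun q => ∫ t in (0 : ℝ)..q, v t * allocSlope m w t with hI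
  have hII : ∀ x ∈ Set.Icc (0 : ℝ) 1, ∀ y ∈ Set.Icc (0 : ℝ) 1,
      I y - I x = ∫ t in x..y, v t * allocSlope m w t := fun x hx y hy =>
    intervalIntegral.integral_interval_sub_left
      (hv.intervalIntegrable_mul (continuous_allocSlope m w) h0 hy)
      (hv.intervalIntegrable_mul (continuous_allocSlope m w) h0 hx)
  -- Both the bid and the integral grow between `x` and `y` by an amount between `v x` and `v y`
  -- times the gain in allocation.
  have key := eq_of_abs_sub_le_mul_sub (f := fun q => b q - I q) (L := m + 1) (by positivity) hv
    (fun x hx y hy hxy => by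
      have hsub : ∀ t ∈ Set.Icc x y, t ∈ Set.Icc (0 : ℝ) 1 :=
        fun t ht => ⟨hx.1.trans ht.1, ht.2.trans hy.2⟩
      have hvi := hv.intervalIntegrable_mul (continuous_allocSlope m w) hx hy
      have hlo : v x * (alloc (m + 2) w y - alloc (m + 2) w x) ≤ I y - I x := by
        rw [hII x hx y hy, ← hX, ← intervalIntegral.integral_const_mul]
        exact intervalIntegral.integral_mono_on hxy ((hgi x y).const_mul _) hvi fun t ht =>
          mul_le_mul_of_nonneg_right (hv.monotone hx (hsub t ht) ht.1)
            (hw.allocSlope_mem (hsub t ht)).1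
      have hhi : I y - I x ≤ v y * (alloc (m + 2) w y - alloc (m + 2) w x) := by
        rw [hII x hx y hy, ← hX, ← intervalIntegral.integral_const_mul]
        exact intervalIntegral.integral_mono_on hxy hvi ((hgi x y).const_mul _) fun t ht =>
          mul_le_mul_of_nonneg_right (hv.monotone (hsub t ht) hy ht.2)
            (hw.allocSlope_mem (hsub t ht)).1
      have hLip : alloc (m + 2) w y - alloc (m + 2) w x ≤ (m + 1) * (y - x) := by
        have := intervalIntegral.integral_mono_on hxy (hgi x y)
          (intervalIntegrable_const (c := (m + 1 : ℝ)))
          fun t ht => (hw.allocSlope_mem (hsub t ht)).2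
        rw [hX, intervalIntegral.integral_const, smul_eq_mul] at this
        linarith
      have h1 := hbr x hx y hy
      have h2 := hbr y hy x hx
      have hvxy := sub_nonneg.2 (hv.monotone hx hy hxy)
      have h3 := mul_le_mul_of_nonneg_right hLip hvxy
      rw [abs_le]
      constructor <;> linarith) hq
  have hI0 : I 0 = 0 := by simp [hI]
  simp only [hb0, hI0, sub_zero] at key
  linarith

/-! ### Multi-unit revenues -/

lemma slopeCoeff_kUnit {m k a : ℕ} (hk : k ∈ Set.Icc 1 (m + 1)) (ha : a ≤ m) :
    slopeCoeff m (kUnit k) a = if a = m + 1 - k then 1 else 0 := by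
  obtain ⟨h1, h2⟩ := hk
  unfold slopeCoeff kUnit
  split_ifs <;> first | omega | norm_num

lemma allocSlope_kUnit {m k : ℕ} (hk : k ∈ Set.Icc 1 (m + 1)) (t : ℝ) :
    allocSlope m (kUnit k) t = (m + 1) * binom m (m + 1 - k) t := by
  obtain ⟨h1, h2⟩ := hk
  have : ∀ a ∈ Finset.range (m + 1), slopeCoeff m (kUnit k) a * binom m a t =
      if a = m + 1 - k then binom m a t else 0 := fun a ha => by
    rw [Finset.mem_range] at ha
    rw [slopeCoeff_kUnit ⟨h1, h2⟩ (by omega), ite_mul, one_mul, zero_mul]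
  rw [allocSlope, Finset.sum_congr rfl this, Finset.sum_ite_eq',
    if_pos (Finset.mem_range.2 (by omega))]

lemma allocSlope_kUnit_all (m : ℕ) (t : ℝ) : allocSlope m (kUnit (m + 2)) t = 0 := by
  have : ∀ a ∈ Finset.range (m + 1), slopeCoeff m (kUnit (m + 2)) a * binom m a t = 0 :=
    fun a _ => by
      simp [slopeCoeff, kUnit, show m + 1 - a ≤ m + 2 by omega]
  rw [allocSlope, Finset.sum_eq_zero this, mul_zero]

lemma revenue_eq (m : ℕ) (w : ℕ → ℝ) (v : ℝ → ℝ) :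
    revenue (m + 2) w v = ∫ t in (0 : ℝ)..1, v t * ((1 - t) * allocSlope m w t) := by
  unfold revenue revenueCurve
  congr 1
  ext t
  rw [(hasDerivAt_alloc m w t).deriv]
  ring

lemma allocSlope_eq_sum_marginal (m : ℕ) (y : ℕ → ℝ) (t : ℝ) :
    allocSlope m y t =
      ∑ k ∈ Finset.Icc 1 (m + 2), marginal (m + 2) y k * allocSlope m (kUnit k) t := by
  rw [Finset.sum_Icc_succ_top (by omega), allocSlope_kUnit_all, mul_zero, add_zero,
    ← Finset.Ico_add_one_right_eq_Icc, Finset.sum_Ico_eq_sum_range,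
    show m + 1 + 1 - 1 = m + 1 by omega, ← Finset.sum_range_reflect, allocSlope, Finset.mul_sum]
  refine Finset.sum_congr rfl fun a ha => ?_
  rw [Finset.mem_range] at ha
  rw [allocSlope_kUnit ⟨by omega, by omega⟩, marginal, if_neg (by omega), slopeCoeff,
    show 1 + (m + 1 - 1 - a) = m + 1 - a by omega, show m + 1 - a + 1 = m + 2 - a by omega,
    show m + 1 - (m + 1 - a) = a by omega]
  ring

lemma revenue_eq_sum_marginal (m : ℕ) (y : ℕ → ℝ) {v : ℝ → ℝ} (hv : IsValueFunction v) :
    revenue (m + 2) y v =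
      ∑ k ∈ Finset.Icc 1 (m + 2), marginal (m + 2) y k * revenue (m + 2) (kUnit k) v := by
  simp only [revenue_eq, ← intervalIntegral.integral_const_mul]
  rw [← intervalIntegral.integral_finsetSum]
  · congr 1
    ext t
    rw [allocSlope_eq_sum_marginal, Finset.mul_sum, Finset.mul_sum]
    exact Finset.sum_congr rfl fun k _ => by ring
  · intro k _
    have : Continuous fun t => (1 - t) * allocSlope m (kUnit k) t :=
      (continuous_const.sub continuous_id).mul (continuous_allocSlope _ _)
    exact (hv.intervalIntegrable_mul this (Set.left_mem_Icc.2 zero_le_one)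
      (Set.right_mem_Icc.2 zero_le_one)).const_mul _

lemma IsPositionWeights.marginal_nonneg {n : ℕ} {y : ℕ → ℝ} (hy : IsPositionWeights n y) {k : ℕ}
    (hk : k ∈ Set.Icc 1 n) : 0 ≤ marginal n y k := by
  obtain ⟨h1, h2⟩ := hk
  unfold marginal
  split_ifs with h
  · exact (hy.mem_unit n ⟨h ▸ h1, le_rfl⟩).1
  · exact sub_nonneg.2 (hy.antitone ⟨h1, h2⟩ ⟨by omega, by omega⟩ (by omega))

lemma sum_marginal (m : ℕ) (y : ℕ → ℝ) :
    ∑ k ∈ Finset.Icc 1 (m + 2), marginal (m + 2) y k = y 1 := by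
  have h : ∀ k ∈ Finset.Icc 1 (m + 1), marginal (m + 2) y k = y k - y (k + 1) := fun k hk => by
    rw [Finset.mem_Icc] at hk
    rw [marginal, if_neg (by omega)]
  rw [Finset.sum_Icc_succ_top (by omega), Finset.sum_congr rfl h,
    ← Finset.Ico_add_one_right_eq_Icc, Finset.sum_Ico_eq_sum_range]
  have h2 := Finset.sum_range_sub' (fun i => y (1 + i)) (m + 1)
  simp only [← add_assoc, add_zero] at h2
  rw [show m + 1 + 1 - 1 = m + 1 by omega, h2, marginal, if_pos rfl,
    show 1 + m + 1 = m + 2 by omega]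
  ring

/-- The marginal weights form a subprobability vector, so the error for a position auction is at
most the largest error for the multi-unit auctions. -/
lemma EstimatesMultiUnit.estimatesPosition {m N : ℕ} {w : ℕ → ℝ} {c : ℕ → Fin N → ℝ} {δ : ℝ}
    (h : EstimatesMultiUnit (m + 2) N w c δ) : EstimatesPosition (m + 2) N w c δ := by
  intro v b hv hb y hy
  refine (lintegral_mono fun β => ?_).trans (h v b hv hb)
  set e : ℕ → ℝ := fun k => |orderStat (c k) β - revenue (m + 2) (kUnit k) v| with he
  have hnn : ∀ k ∈ Finset.Icc 1 (m + 2), 0 ≤ marginal (m + 2) y k := fun k hk =>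
    hy.marginal_nonneg (by simpa using hk)
  obtain ⟨K, hK, hmax⟩ := Finset.exists_max_image (Finset.Icc 1 (m + 2)) e ⟨1, by simp⟩
  have hle : |∑ k ∈ Finset.Icc 1 (m + 2), marginal (m + 2) y k * orderStat (c k) β -
      revenue (m + 2) y v| ≤ e K := by
    rw [revenue_eq_sum_marginal m y hv, ← Finset.sum_sub_distrib]
    calc _ ≤ ∑ k ∈ Finset.Icc 1 (m + 2), marginal (m + 2) y k * e K := by
          refine (Finset.abs_sum_le_sum_abs _ _).trans (Finset.sum_le_sum fun k hk => ?_)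
          rw [← mul_sub, abs_mul, abs_of_nonneg (hnn k hk)]
          exact mul_le_mul_of_nonneg_left (hmax k hk) (hnn k hk)
      _ = y 1 * e K := by rw [← Finset.sum_mul, sum_marginal]
      _ ≤ e K := mul_le_of_le_one_left (abs_nonneg _) (hy.mem_unit 1 ⟨le_rfl, by omega⟩).2
  refine (ENNReal.ofReal_le_ofReal hle).trans ?_
  exact le_iSup₂ (f := fun k (_ : k ∈ Set.Icc 1 (m + 2)) =>
    ENNReal.ofReal |orderStat (c k) β - revenue (m + 2) (kUnit k) v|) K (by simpa using hK)

/-! ### Weighted order statistics as integrals -/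

lemma sum_range_ite_sub (Z : ℕ → ℝ) {S N : ℕ} (h : S ≤ N) :
    ∑ i ∈ Finset.range N, (if S ≤ i then Z i - Z (i + 1) else 0) = Z S - Z N := by
  induction N, h using Nat.le_induction with
  | base =>
    rw [sub_self]
    exact Finset.sum_eq_zero fun i hi => if_neg (by rw [Finset.mem_range] at hi; omega)
  | succ N h ih => rw [Finset.sum_range_succ, ih, if_pos h]; ring

/-- The integral of `ρ` below the quantile `u`, as a function defined for all real `u`. For
`ρ t = v t * allocSlope m w t` and `ν` uniform on `(0, 1)` it is the equilibrium bid at `u`. -/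
noncomputable def bidIntegral (ν : Measure ℝ) (ρ : ℝ → ℝ) (u : ℝ) : ℝ :=
  ∫ t, (if t < u then ρ t else 0) ∂ν

lemma integrable_ite_lt {ν : Measure ℝ} {ρ : ℝ → ℝ} (hρ : Integrable ρ ν) (u : ℝ) :
    Integrable (fun t => if t < u then ρ t else 0) ν := by
  classical
  exact (hρ.indicator measurableSet_Iio (s := Set.Iio u)).congr
    (Filter.Eventually.of_forall fun t => by simp [Set.indicator_apply])

lemma monotone_bidIntegral {ν : Measure ℝ} {ρ : ℝ → ℝ} (hρ : Integrable ρ ν)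
    (h0 : ∀ᵐ t ∂ν, 0 ≤ ρ t) : Monotone (bidIntegral ν ρ) := by
  intro u u' h
  refine integral_mono_ae (integrable_ite_lt hρ u) (integrable_ite_lt hρ u') ?_
  filter_upwards [h0] with t ht
  split_ifs with h1 h2
  exacts [le_rfl, absurd (h1.trans_le h) h2, ht, le_rfl]

/-- The order statistic with coefficients `Z i - Z (i + 1)` integrates `Z` at the empirical
counts: the `i`-th smallest quantile exceeds `t` exactly if at most `i` of the quantiles are at
most `t` (counting `i` from `0`). -/
lemma orderStat_bidIntegral {N : ℕ} {ν : Measure ℝ} {ρ : ℝ → ℝ} (hρ : Integrable ρ ν)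
    (h0 : ∀ᵐ t ∂ν, 0 ≤ ρ t) {Z : ℕ → ℝ} (hZ : Z N = 0) (u : Fin N → ℝ) :
    Integrable (fun t => ρ t * Z (Finset.univ.filter fun i => u i ≤ t).card) ν ∧
    orderStat (fun i : Fin N => Z i - Z (i + 1)) (fun i => bidIntegral ν ρ (u i)) =
      ∫ t, ρ t * Z (Finset.univ.filter fun i => u i ≤ t).card ∂ν := by
  set σ := Tuple.sort u with hσ
  have hmono : Monotone (u ∘ σ) := Tuple.monotone_sort u
  have hsort : ∀ i, bidIntegral ν ρ (u (Tuple.sort (fun i => bidIntegral ν ρ (u i)) i)) =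
      bidIntegral ν ρ (u (σ i)) := by
    have h : Monotone ((fun i => bidIntegral ν ρ (u i)) ∘ σ) :=
      (monotone_bidIntegral hρ h0).comp hmono
    exact fun i => (congrFun (Tuple.comp_sort_eq_comp_iff_monotone.2 h) i).symm
  have hcard : ∀ t, (Finset.univ.filter fun i => u i ≤ t).card =
      (Finset.univ.filter fun i => (u ∘ σ) i ≤ t).card := fun t => by
    refine (Finset.card_bij (fun i _ => σ i) (by simp) (fun _ _ _ _ h => σ.injective h) ?_).symm
    intro i hi
    exact ⟨σ.symm i, by simpa using hi, by simp⟩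
  have hlt : ∀ t (i : Fin N), t < u (σ i) ↔
      (Finset.univ.filter fun i => u i ≤ t).card ≤ i := fun t i => by
    rw [hcard]
    exact (not_le.symm.trans
      (not_congr (Tuple.lt_card_le_iff_apply_le_of_monotone hmono).symm)).trans not_lt
  have hsum : ∀ t, ρ t * Z (Finset.univ.filter fun i => u i ≤ t).card =
      ∑ i : Fin N, (Z i - Z (i + 1)) * (if t < u (σ i) then ρ t else 0) := fun t => by
    have hS : (Finset.univ.filter fun i => u i ≤ t).card ≤ N :=
      (Finset.card_le_univ _).trans_eq (Fintype.card_fin N)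
    have h := sum_range_ite_sub Z hS
    rw [hZ, sub_zero] at h
    rw [← h, Finset.mul_sum, ← Fin.sum_univ_eq_sum_range
      (fun i => ρ t * if (Finset.univ.filter fun i => u i ≤ t).card ≤ i then Z i - Z (i + 1) else 0)]
    refine Finset.sum_congr rfl fun i _ => ?_
    simp only [hlt, mul_ite, mul_zero, mul_comm]
  have hint : ∀ i : Fin N, Integrable
      (fun t => (Z i - Z (i + 1)) * (if t < u (σ i) then ρ t else 0)) ν :=
    fun i => (integrable_ite_lt hρ _).const_mul _
  simp_rw [hsum]
  refine ⟨integrable_finsetSum _ fun i _ => hint i, ?_⟩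
  rw [integral_finsetSum _ fun i _ => hint i, orderStat]
  refine Finset.sum_congr rfl fun i _ => ?_
  rw [integral_const_mul, hsort, bidIntegral]

/-! ### The estimators and their error -/

/-- The coefficients that estimate the `k`-unit revenue among `m + 2` agents from `N + 1` bids:
the successive differences of the estimated ratio of the slope of the `k`-unit allocation rule,
times `1 - t`, to the slope of the allocation rule of `w`. -/
noncomputable def estimatorCoeff (m N : ℕ) (w : ℕ → ℝ) (k : ℕ) (i : Fin (N + 1)) : ℝ :=
  if k ≤ m + 1 then
    ratioEst m N (slopeCoeff m w) (m + 1 - k) i - ratioEst m N (slopeCoeff m w) (m + 1 - k) (i + 1)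
  else 0

lemma enorm_estimate_sub_revenue_le {m N : ℕ} {w : ℕ → ℝ} (hw : IsPositionWeights (m + 2) w)
    (hpos : 0 < slopeCoeff m w m) {v : ℝ → ℝ} (hv : IsValueFunction v) {k : ℕ}
    (hk : k ∈ Set.Icc 1 (m + 2)) (u : Fin (N + 1) → ℝ) :
    ENNReal.ofReal |orderStat (estimatorCoeff m N w k) (fun i => bidIntegral
        (volume.restrict (Set.Ioo 0 1)) (fun t => v t * allocSlope m w t) (u i)) -
      revenue (m + 2) (kUnit k) v| ≤
    ∫⁻ t in Set.Ioo 0 1,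
      ENNReal.ofReal (errBound m N (Finset.univ.filter fun i => u i ≤ t).card t) := by
  have hint : ∀ g : ℝ → ℝ, Continuous g →
      Integrable (fun t => v t * g t) (volume.restrict (Set.Ioo 0 1)) := fun g hg => by
    have h := hv.intervalIntegrable_mul hg (Set.left_mem_Icc.2 zero_le_one)
      (Set.right_mem_Icc.2 zero_le_one)
    rw [intervalIntegrable_iff_integrableOn_Ioo_of_le zero_le_one] at h
    exact h
  have hrev : revenue (m + 2) (kUnit k) v =
      ∫ t in Set.Ioo 0 1, v t * ((1 - t) * allocSlope m (kUnit k) t) := by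
    rw [revenue_eq, intervalIntegral.integral_of_le zero_le_one, integral_Ioc_eq_integral_Ioo]
  rcases Nat.lt_or_ge (m + 1) k with hlt | hle
  · -- If every agent is served, the revenue vanishes, and so does its estimate.
    obtain rfl : k = m + 2 := le_antisymm hk.2 hlt
    have h0 : orderStat (estimatorCoeff m N w (m + 2)) (fun i => bidIntegral
        (volume.restrict (Set.Ioo 0 1)) (fun t => v t * allocSlope m w t) (u i)) = 0 :=
      Finset.sum_eq_zero fun i _ => by rw [estimatorCoeff, if_neg (by omega), zero_mul]
    rw [hrev, h0]
    simp [allocSlope_kUnit_all]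
  · have hρ0 : ∀ᵐ t ∂(volume.restrict (Set.Ioo (0 : ℝ) 1)), 0 ≤ v t * allocSlope m w t := by
      filter_upwards [ae_restrict_mem measurableSet_Ioo] with t ht
      have ht' := Set.Ioo_subset_Icc_self ht
      exact mul_nonneg (hv.mem_unit t ht').1 (hw.allocSlope_mem ht').1
    have hc : estimatorCoeff m N w k = fun i : Fin (N + 1) =>
        ratioEst m N (slopeCoeff m w) (m + 1 - k) i -
          ratioEst m N (slopeCoeff m w) (m + 1 - k) (i + 1) := by
      ext i; rw [estimatorCoeff, if_pos hle]
    obtain ⟨hi, he⟩ := orderStat_bidIntegral (hint _ (continuous_allocSlope m w)) hρ0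
      (ratioEst_last m N (slopeCoeff m w) (m + 1 - k)) u
    have hcont : Continuous fun t => (1 - t) * allocSlope m (kUnit k) t :=
      (continuous_const.sub continuous_id).mul (continuous_allocSlope _ _)
    rw [hc, he, hrev, ← integral_sub hi (hint _ hcont), ← Real.norm_eq_abs, ofReal_norm]
    refine (enorm_integral_le_lintegral_enorm _).trans (lintegral_mono_ae ?_)
    filter_upwards [ae_restrict_mem measurableSet_Ioo] with t ht
    have ht' := Set.Ioo_subset_Icc_self ht
    rw [← ofReal_norm, Real.norm_eq_abs, mul_assoc, ← mul_sub, abs_mul,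
      abs_of_nonneg (hv.mem_unit t ht').1]
    refine ENNReal.ofReal_le_ofReal
      ((mul_le_of_le_one_left (abs_nonneg _) (hv.mem_unit t ht').2).trans ?_)
    rw [allocSlope_kUnit ⟨hk.1, hle⟩]
    exact abs_slope_mul_ratioEst_sub_le (fun j hj => hw.slopeCoeff_nonneg hj) ⟨m, le_rfl, hpos⟩
      (by have := hk.1; omega)
      ((Finset.card_le_univ _).trans_eq (Fintype.card_fin _)) ht

lemma lintegral_errBound_le (m N : ℕ) :
    ∫⁻ u, (∫⁻ t in Set.Ioo 0 1,
        ENNReal.ofReal (errBound m N (Finset.univ.filter fun i => u i ≤ t).card t))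
      ∂(Measure.pi fun _ : Fin (N + 1) => quantileLaw) ≤
    ENNReal.ofReal ((m + 1) * (2 * m + 1) / √(N + 1 : ℕ)) := by
  have hmeas : Measurable fun p : (Fin (N + 1) → ℝ) × ℝ =>
      ENNReal.ofReal (errBound m N (Finset.univ.filter fun i => p.1 i ≤ p.2).card p.2) := by
    have h1 : Measurable fun p : (Fin (N + 1) → ℝ) × ℝ =>
        ((Finset.univ.filter fun i => p.1 i ≤ p.2).card, p.2) := by
      refine Measurable.prodMk ?_ measurable_snd
      simp only [Finset.card_filter]
      exact Finset.measurable_fun_sum _ fun i _ => Measurable.ite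
        (measurableSet_le ((measurable_pi_apply i).comp measurable_fst) measurable_snd)
        measurable_const measurable_const
    have h2 : Measurable fun p : ℕ × ℝ => ENNReal.ofReal (errBound m N p.1 p.2) :=
      measurable_from_prod_countable_right fun S => (measurable_errBound m N S).ennreal_ofReal
    have h3 := h2.comp h1
    simp only [Function.comp_def] at h3
    exact h3
  rw [lintegral_lintegral_swap hmeas.aemeasurable]
  have hint : IntegrableOn
      (fun t : ℝ => (m + 1) / √(N + 1 : ℕ) * (m * t ^ (-(1 / 2) : ℝ) + 1)) (Set.Ioo 0 1) := by
    have h : IntervalIntegrable (fun t : ℝ => t ^ (-(1 / 2) : ℝ)) volume 0 1 :=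
      intervalIntegral.intervalIntegrable_rpow' (by norm_num)
    rw [← intervalIntegrable_iff_integrableOn_Ioo_of_le zero_le_one]
    exact ((h.const_mul _).add intervalIntegrable_const).const_mul _
  calc _ ≤ ∫⁻ t in Set.Ioo (0 : ℝ) 1,
        ENNReal.ofReal ((m + 1) / √(N + 1 : ℕ) * (m * t ^ (-(1 / 2) : ℝ) + 1)) := by
        refine setLIntegral_mono' measurableSet_Ioo fun t ht => ?_
        have ht' := Set.Ioo_subset_Icc_self ht
        have h := lintegral_card_filter_mem (N + 1) quantileLaw (measurableSet_Iic (a := t))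
          fun S => ENNReal.ofReal (errBound m N S t)
        rw [quantileLaw_real_Iic ht'] at h
        refine (le_of_eq h).trans ?_
        rw [Finset.sum_congr rfl fun S _ => (ENNReal.ofReal_mul (errBound_nonneg ht')).symm,
          ← ENNReal.ofReal_sum_of_nonneg fun S _ =>
            mul_nonneg (errBound_nonneg ht') (binom_nonneg _ _ ht')]
        refine ENNReal.ofReal_le_ofReal ((le_of_eq ?_).trans (sum_binom_mul_errBound_le m N ht))
        exact Finset.sum_congr rfl fun S _ => mul_comm _ _
    _ = ENNReal.ofReal (∫ t in Set.Ioo (0 : ℝ) 1,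
          (m + 1) / √(N + 1 : ℕ) * (m * t ^ (-(1 / 2) : ℝ) + 1)) := by
        refine (ofReal_integral_eq_lintegral_ofReal hint ?_).symm
        filter_upwards [ae_restrict_mem measurableSet_Ioo] with t ht
        have := Real.rpow_nonneg ht.1.le (-(1 / 2))
        dsimp only [Pi.zero_apply]
        positivity
    _ = _ := by
        congr 1
        have h : IntervalIntegrable (fun t : ℝ => t ^ (-(1 / 2) : ℝ)) volume 0 1 :=
          intervalIntegral.intervalIntegrable_rpow' (by norm_num)
        rw [← integral_Ioc_eq_integral_Ioo, ← intervalIntegral.integral_of_le zero_le_one,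
          intervalIntegral.integral_const_mul,
          intervalIntegral.integral_add (h.const_mul _) intervalIntegrable_const,
          intervalIntegral.integral_const_mul, integral_rpow (Or.inl (by norm_num)),
          intervalIntegral.integral_const, Real.zero_rpow (by norm_num)]
        norm_num
        ring

/-- The bound needs only that the highest position has a larger weight than the second one, and it
does not depend on by how much. -/
theorem estimatesMultiUnit_estimatorCoeff {m N : ℕ} {w : ℕ → ℝ} (hw : IsPositionWeights (m + 2) w)
    (hpos : 0 < slopeCoeff m w m) :
    EstimatesMultiUnit (m + 2) (N + 1) w (estimatorCoeff m N w)
      ((m + 1) * (2 * m + 1) / √(N + 1 : ℕ)) := by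
  intro v b hv hb
  set ρ : ℝ → ℝ := fun t => v t * allocSlope m w t with hρ
  set B := bidIntegral (volume.restrict (Set.Ioo 0 1)) ρ with hB
  have hρi : Integrable ρ (volume.restrict (Set.Ioo 0 1)) := by
    have h := hv.intervalIntegrable_mul (continuous_allocSlope m w)
      (Set.left_mem_Icc.2 zero_le_one) (Set.right_mem_Icc.2 zero_le_one)
    rwa [intervalIntegrable_iff_integrableOn_Ioo_of_le zero_le_one] at h
  have hρ0 : ∀ᵐ t ∂(volume.restrict (Set.Ioo (0 : ℝ) 1)), 0 ≤ ρ t := by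
    filter_upwards [ae_restrict_mem measurableSet_Ioo] with t ht
    have ht' := Set.Ioo_subset_Icc_self ht
    exact mul_nonneg (hv.mem_unit t ht').1 (hw.allocSlope_mem ht').1
  -- `b` is arbitrary outside `[0, 1]`, while `B` is monotone, hence measurable, on all of `ℝ`.
  have hbB : b =ᵐ[quantileLaw] B := by
    filter_upwards [ae_quantile_mem_Ioc] with q hq
    have e : (fun t => if t < q then ρ t else 0) = (Set.Iio q).indicator ρ := by
      ext t; simp [Set.indicator_apply]
    have hset : Set.Iio q ∩ Set.Ioo 0 1 = Set.Ioo 0 q := by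
      ext t; simp only [Set.mem_inter_iff, Set.mem_Iio, Set.mem_Ioo]
      exact ⟨fun h => ⟨h.2.1, h.1⟩, fun h => ⟨h.2, h.1, h.2.trans_le hq.2⟩⟩
    rw [hb.bid_eq_integral hw hv (Set.Ioc_subset_Icc_self hq), hB, bidIntegral, e,
      integral_indicator measurableSet_Iio, Measure.restrict_restrict measurableSet_Iio, hset,
      intervalIntegral.integral_of_le hq.1.le, integral_Ioc_eq_integral_Ioo]
  have hBm : Measurable B := (monotone_bidIntegral hρi hρ0).measurable
  have hlaw : sampleLaw (N + 1) b =
      (Measure.pi fun _ : Fin (N + 1) => quantileLaw).map fun u i => B (u i) := by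
    have : IsProbabilityMeasure (quantileLaw.map B) :=
      Measure.isProbabilityMeasure_map hBm.aemeasurable
    rw [sampleLaw, Measure.map_congr hbB,
      Measure.pi_map_pi (f := fun _ => B) fun _ => hBm.aemeasurable]
  rw [hlaw]
  refine (lintegral_map_le _ _).trans ((lintegral_mono fun u => ?_).trans
    (lintegral_errBound_le m N))
  exact iSup₂_le fun k hk => enorm_estimate_sub_revenue_le hw hpos hv hk u

/-! ### The universal test -/

lemma universalB_isPositionWeights (n : ℕ) (hn : 2 ≤ n) : IsPositionWeights n (universalB n) where
  mem_unit k _ := by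
    unfold universalB
    split_ifs <;> constructor <;> norm_num
  antitone := by
    intro j hj k hk hjk
    have := hj.1
    unfold universalB
    split_ifs <;> first | omega | norm_num

lemma IsPositionWeights.mix {n : ℕ} {a b : ℕ → ℝ} (ha : IsPositionWeights n a)
    (hb : IsPositionWeights n b) {ε : ℝ} (h0 : 0 ≤ ε) (h1 : ε ≤ 1) :
    IsPositionWeights n (mix ε a b) where
  mem_unit k hk := by
    have h1' := sub_nonneg.2 h1
    obtain ⟨ha0, ha1⟩ := ha.mem_unit k hk
    obtain ⟨hb0, hb1⟩ := hb.mem_unit k hk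
    constructor
    · unfold PositionAuction.mix; positivity
    · unfold PositionAuction.mix; nlinarith
  antitone j hj k hk hjk :=
    add_le_add (mul_le_mul_of_nonneg_left (ha.antitone hj hk hjk) (sub_nonneg.2 h1))
      (mul_le_mul_of_nonneg_left (hb.antitone hj hk hjk) h0)

lemma EstimatesMultiUnit.mono {n N : ℕ} {w : ℕ → ℝ} {c : ℕ → Fin N → ℝ} {δ δ' : ℝ}
    (h : EstimatesMultiUnit n N w c δ) (hδ : δ ≤ δ') : EstimatesMultiUnit n N w c δ' :=
  fun v b hv hb => (h v b hv hb).trans (ENNReal.ofReal_le_ofReal hδ)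

lemma exists_estimatesMultiUnit_mix_universalB {n N : ℕ} (hn : 2 ≤ n) (hN : 1 ≤ N) {a : ℕ → ℝ}
    (ha : IsPositionWeights n a) {ε : ℝ} (h0 : 0 < ε) (h1 : ε ≤ 1) :
    ∃ c : ℕ → Fin N → ℝ, EstimatesMultiUnit n N (mix ε a (universalB n)) c
      (40 * n * (n + Real.log (1 / ε)) / √N) := by
  obtain ⟨m, rfl⟩ := Nat.exists_eq_add_of_le' hn
  obtain ⟨N, rfl⟩ := Nat.exists_eq_add_of_le' hN
  have hw := ha.mix (universalB_isPositionWeights _ hn) h0.le h1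
  have hpos : 0 < slopeCoeff m (mix ε a (universalB (m + 2))) m := by
    have hB : (1 / 2 : ℝ) ≤ universalB (m + 2) 1 - universalB (m + 2) 2 := by
      unfold universalB
      split_ifs <;> first | omega | norm_num
    have hA : 0 ≤ a 1 - a 2 :=
      sub_nonneg.2 (ha.antitone ⟨le_rfl, by omega⟩ ⟨by omega, by omega⟩ (by omega))
    have h2 := sub_nonneg.2 h1
    rw [slopeCoeff, show m + 1 - m = 1 by omega, show m + 2 - m = 2 by omega, mix, mix]
    nlinarith [mul_nonneg h2 hA, mul_le_mul_of_nonneg_left hB h0.le]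
  refine ⟨_, (estimatesMultiUnit_estimatorCoeff hw hpos).mono ?_⟩
  have hlog : 0 ≤ Real.log (1 / ε) := Real.log_nonneg (by rwa [le_div_iff₀ h0, one_mul])
  refine div_le_div_of_nonneg_right ?_ (Real.sqrt_nonneg _)
  push_cast
  have hm : (0 : ℝ) ≤ m := Nat.cast_nonneg m
  nlinarith [mul_nonneg hm hlog, mul_nonneg hm hm]

end PositionAuction

theorem mainTheorem6 (n : ℕ) (hn : 2 ≤ n) :
    (∀ k ∈ Set.Icc 1 n, PositionAuction.universalB n k =
      PositionAuction.mix (1 / 2) (PositionAuction.kUnit 1) (PositionAuction.kUnit (n - 1)) k) ∧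
    (∀ N : ℕ, 1 ≤ N → ∀ a : ℕ → ℝ, PositionAuction.IsPositionWeights n a →
      ∀ ε : ℝ, 0 < ε → ε ≤ 1 →
        ∃ c : ℕ → Fin N → ℝ,
          PositionAuction.EstimatesMultiUnit n N
            (PositionAuction.mix ε a (PositionAuction.universalB n)) c
            (40 * n * (n + Real.log (1 / ε)) / √N) ∧
          PositionAuction.EstimatesPosition n N
            (PositionAuction.mix ε a (PositionAuction.universalB n)) c
            (40 * n * (n + Real.log (1 / ε)) / √N)) ∧
    PositionAuction.IsUniversalBTest n (PositionAuction.universalB n) := by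
  refine ⟨fun k hk => ?_, fun N hN a ha ε h0 h1 => ?_, ?_⟩
  · obtain ⟨h1, h2⟩ := hk
    unfold PositionAuction.universalB PositionAuction.mix PositionAuction.kUnit
    split_ifs <;> first | omega | norm_num
  · obtain ⟨c, hc⟩ :=
      PositionAuction.exists_estimatesMultiUnit_mix_universalB hn hN ha h0 h1
    obtain ⟨m, rfl⟩ := Nat.exists_eq_add_of_le' hn
    exact ⟨c, hc, hc.estimatesPosition⟩
  · -- For `ε ≤ 1 / 2` the summand `n` is at most `n / log 2` times `log (1 / ε)`.
    refine ⟨40 * n * (n / Real.log 2 + 1), fun N hN a ha ε h0 h1 => ?_⟩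
    obtain ⟨c, hc⟩ :=
      PositionAuction.exists_estimatesMultiUnit_mix_universalB hn hN ha h0 (by linarith)
    refine ⟨c, hc.mono ?_⟩
    have hl2 : 0 < Real.log 2 := Real.log_pos one_lt_two
    have hl : Real.log 2 ≤ Real.log (1 / ε) :=
      Real.log_le_log two_pos (by rw [le_div_iff₀ h0]; linarith)
    have h : (n : ℝ) ≤ n / Real.log 2 * Real.log (1 / ε) := by
      rw [div_mul_eq_mul_div, le_div_iff₀ hl2]; gcongr
    rw [mul_assoc (40 * (n : ℝ))]
    gcongr
    linarith
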